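/- Let $b$ be an indeterminate and $\mathbb{K}=\mathbb{Q}(b)$. Let $\mathcal{P}=\mathbb{K}[p_1,p_2,\dots]$, let $y_0,y_1,\dots$ be further variables, and let $\mathcal{P}_Y=\bigoplus_{i\ge 0} y_i\mathcal{P}$ be the space of polynomials in the $p_j$ and $y_i$ that are homogeneous of degree one in the $y_i$. Define the operators $Y_+,\Gamma_Y\colon\mathcal{P}_Y\to\mathcal{P}_Y$ and $\Theta_Y\colon\mathcal{P}_Y\to\mathcal{P}$ by $$Y_+=\sum_{i\ge 0}y_{i+1}\frac{\partial}{\partial y_i},\qquad \Theta_Y=\sum_{i\ge 1}p_i\frac{\partial}{\partial y_i},$$ $$\Gamma_Y=(1+b)\sum_{i,j\ge 1}y_{i+j}\frac{i\,\partial^2}{\partial p_i\,\partial y_{j-1}}+\sum_{i,j\ge 1}y_i p_j\frac{\partial}{\partial y_{i+j-1}}+b\sum_{i\ge 1}y_{i+1}\frac{i\,\partial}{\partial y_i}.$$ For $n\ge 0$ and a formal variable $u$, let $\mathcal{B}_n(\mathbf{p},u)=\Theta_Y\,(\Gamma_Y+uY_+)^n\,\frac{y_0}{1+b}\colon\mathcal{P}\to\mathcal{P}[u]$,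 where $\frac{y_0}{1+b}$ stands for the operator of multiplication by $\frac{y_0}{1+b}$. For $\ell,k\ge 0$ let $\mathcal{C}_{\ell,k}=[u^\ell]\,\mathcal{B}_{\ell+k}(\mathbf{p},u)\colon\mathcal{P}\to\mathcal{P}$, and for $\ell\ge 0$ let $$\mathcal{C}_\ell=\mathcal{C}_\ell(t,\mathbf{p})=\sum_{k\ge 1}\frac{t^{\ell+k}}{\ell+k}\,\mathcal{C}_{\ell,k}+\mathbb{1}_{\ell>0}\,\frac{t^\ell}{\ell}\,\mathcal{C}_{\ell,0},$$ a formal power series in $t$ whose coefficients are $\mathbb{K}$-linear operators on $\mathcal{P}$. Then, in the ring $\mathrm{End}_{\mathbb{K}}(\mathcal{P})[[t]]$ with its commutator bracket, for every integer $m>0$, $$[\mathcal{C}_\ell,\mathcal{C}_m]=0\quad\text{for all integers }\ell>0,\qquad\text{and}\qquad [\mathcal{C}_0,\mathcal{C}_m]=(m+1)\,\mathcal{C}_{m+1}.$$ -/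

import Mathlib

/- Throughout, `K` is a field with a distinguished element `b`; the theorem uses `K = ℚ(b)`,
the field of rational functions over `ℚ` in the variable `b`. -/

namespace CatalyticOperators

noncomputable section

/-- The sum of a family of linear maps which is locally finite, i.e. such that every vector is
killed by all but finitely many members of the family. -/
def locSum {K M N ι : Type*} [CommSemiring K] [AddCommMonoid M] [AddCommMonoid N]
    [Module K M] [Module K N] (T : ι → M →ₗ[K] N)
    (h : ∀ x, (Function.support fun i => T i x).Finite) : M →ₗ[K] N where
  toFun x := ∑ᶠ i, T i x
  map_add' x y := by
    simp only [map_add]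
    exact finsum_add_distrib (h x) (h y)
  map_smul' c x := by
    simp only [map_smul, RingHom.id_apply]
    exact (smul_finsum' c (h x)).symm

/-- The space `𝒫`, spanned by the power sums `p_λ = p_{λ₁} p_{λ₂} ⋯`: the polynomial ring
`K[p₁, p₂, …]`. -/
abbrev P (K : Type*) [Field K] : Type _ := MvPolynomial ℕ+ K

/-- The space `𝒫_Y`, spanned by the `y_i p_λ` with `i ≥ 0`: the free `𝒫`-module with basis
`y₀, y₁, …`. The element `∑ y_i f_i` is the finitely supported function `i ↦ f_i`. -/
abbrev PY (K : Type*) [Field K] : Type _ := ℕ →₀ P K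

variable (K : Type*) [Field K]

/-- Multiplication by `p_i` on `𝒫`. -/
def mulP (i : ℕ+) : P K →ₗ[K] P K := LinearMap.mulLeft K (MvPolynomial.X i)

/-- The partial derivative `∂/∂p_i` on `𝒫`. -/
def dP (i : ℕ+) : P K →ₗ[K] P K := (MvPolynomial.pderiv i).toLinearMap

/-- Multiplication by `y_i`, from `𝒫` to `𝒫_Y`. -/
def mulY (i : ℕ) : P K →ₗ[K] PY K := Finsupp.lsingle i

/-- The partial derivative `∂/∂y_i`, from `𝒫_Y` to `𝒫`. Elements of `𝒫_Y` are homogeneous of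
degree one in `y₀, y₁, …`, so this is the coefficient of `y_i`. -/
def dY (i : ℕ) : PY K →ₗ[K] P K := Finsupp.lapply i

theorem finite_dY (x : PY K) : {i : ℕ | dY K i x ≠ 0}.Finite := by
  refine x.support.finite_toSet.subset fun i hi => ?_
  simpa [dY] using hi

theorem finite_dP (f : P K) : {i : ℕ+ | dP K i f ≠ 0}.Finite := by
  refine f.vars.finite_toSet.subset fun i hi => ?_
  by_contra hv
  exact hi (MvPolynomial.pderiv_eq_zero_of_notMem_vars hv)

/-- `Y₊ = ∑_{i ≥ 0} y_{i+1} ∂/∂y_i`. -/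
def Yplus : PY K →ₗ[K] PY K :=
  locSum (fun i : ℕ => mulY K (i + 1) ∘ₗ dY K i) (by
    intro x
    refine (finite_dY K x).subset fun i hi h0 => hi ?_
    simp [h0])

/-- `∑_{i,j ≥ 1} y_{i+j} i ∂²/∂p_i∂y_{j-1}`. -/
def gammaJoin : PY K →ₗ[K] PY K :=
  locSum (fun ij : ℕ+ × ℕ+ =>
      mulY K ((ij.1 : ℕ) + ij.2) ∘ₗ (((ij.1 : ℕ) : K) • dP K ij.1) ∘ₗ dY K ((ij.2 : ℕ) - 1)) (by
    intro x
    have hJ : {j : ℕ+ | dY K ((j : ℕ) - 1) x ≠ 0}.Finite := by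
      refine Set.Finite.of_finite_image (f := PNat.natPred)
        ((finite_dY K x).subset ?_) PNat.natPred_injective.injOn
      rintro _ ⟨j, hj, rfl⟩
      exact hj
    refine (hJ.biUnion fun j _ =>
      (finite_dP K (dY K ((j : ℕ) - 1) x)).image fun i => (i, j)).subset ?_
    rintro ⟨i, j⟩ hij
    have hj : dY K ((j : ℕ) - 1) x ≠ 0 := fun h0 => hij (by simp [h0])
    have hi : dP K i (dY K ((j : ℕ) - 1) x) ≠ 0 := fun h0 => hij (by simp [h0])
    exact Set.mem_biUnion hj ⟨i, hi, rfl⟩)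

/-- `∑_{i,j ≥ 1} y_i p_j ∂/∂y_{i+j-1}`. -/
def gammaCut : PY K →ₗ[K] PY K :=
  locSum (fun ij : ℕ+ × ℕ+ =>
      mulY K (ij.1 : ℕ) ∘ₗ mulP K ij.2 ∘ₗ dY K ((ij.1 : ℕ) + ij.2 - 1)) (by
    intro x
    have hS : {ij : ℕ+ × ℕ+ | dY K ((ij.1 : ℕ) + ij.2 - 1) x ≠ 0}.Finite := by
      obtain ⟨N, hN⟩ := (finite_dY K x).bddAbove
      refine ((Set.finite_Iic (⟨N + 1, N.succ_pos⟩ : ℕ+)).prod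
        (Set.finite_Iic (⟨N + 1, N.succ_pos⟩ : ℕ+))).subset ?_
      rintro ⟨i, j⟩ hij
      have h1 : (i : ℕ) + j - 1 ≤ N := hN hij
      have h2 := PNat.pos i
      have h3 := PNat.pos j
      constructor
      · change (i : ℕ) ≤ N + 1
        omega
      · change (j : ℕ) ≤ N + 1
        omega
    refine hS.subset fun ij hij h0 => hij ?_
    simp [h0])

/-- `∑_{i ≥ 1} y_{i+1} i ∂/∂y_i`. -/
def gammaTwist : PY K →ₗ[K] PY K :=
  locSum (fun i : ℕ+ => mulY K ((i : ℕ) + 1) ∘ₗ (((i : ℕ) : K) • dY K (i : ℕ))) (by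
    intro x
    have hS : {i : ℕ+ | dY K i x ≠ 0}.Finite := by
      refine Set.Finite.of_finite_image (f := fun i : ℕ+ => (i : ℕ))
        ((finite_dY K x).subset ?_) PNat.coe_injective.injOn
      rintro _ ⟨j, hj, rfl⟩
      exact hj
    refine hS.subset fun i hi h0 => hi ?_
    simp [h0])

/-- `Θ_Y = ∑_{i ≥ 1} p_i ∂/∂y_i`, from `𝒫_Y` to `𝒫`. -/
def Theta : PY K →ₗ[K] P K :=
  locSum (fun i : ℕ+ => mulP K i ∘ₗ dY K (i : ℕ)) (by
    intro x
    have hS : {i : ℕ+ | dY K i x ≠ 0}.Finite := by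
      refine Set.Finite.of_finite_image (f := fun i : ℕ+ => (i : ℕ))
        ((finite_dY K x).subset ?_) PNat.coe_injective.injOn
      rintro _ ⟨j, hj, rfl⟩
      exact hj
    refine hS.subset fun i hi h0 => hi ?_
    simp [h0])

variable {K} (b : K)

/-- `Γ_Y = (1+b) ∑ y_{i+j} i∂²/∂p_i∂y_{j-1} + ∑ y_i p_j ∂/∂y_{i+j-1} + b ∑ y_{i+1} i∂/∂y_i`. -/
def Gamma : PY K →ₗ[K] PY K :=
  (1 + b) • gammaJoin K + gammaCut K + b • gammaTwist K

/-- `ℬ_n(𝐩, u) = Θ_Y (Γ_Y + u Y₊)ⁿ (y₀ / (1 + b))`, as a polynomial in the central variable `u`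
whose coefficients are operators on `𝒫`. -/
def B (n : ℕ) : Polynomial (Module.End K (P K)) :=
  ((Polynomial.C (Gamma b : Module.End K (PY K)) +
      Polynomial.X * Polynomial.C (Yplus K : Module.End K (PY K))) ^ n).sum
    fun r T => Polynomial.monomial r (Theta K ∘ₗ T ∘ₗ ((1 + b)⁻¹ • mulY K 0))

/-- `𝒞_{ℓ,k}(𝐩) = [u^ℓ] ℬ_{ℓ+k}(𝐩, u)`. -/
def Ccoef (ℓ k : ℕ) : Module.End K (P K) := (B b (ℓ + k)).coeff ℓ

/-- `𝒞_ℓ(t, 𝐩) = ∑_{k ≥ 1} t^{ℓ+k}/(ℓ+k) 𝒞_{ℓ,k}(𝐩) + 𝟙_{ℓ>0} t^ℓ/ℓ 𝒞_{ℓ,0}(𝐩)`, as a power series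
in the central variable `t` whose coefficients are operators on `𝒫`. The coefficient of `t^n` is
`(1/n) 𝒞_{ℓ,n-ℓ}` if `n ≥ ℓ` and `n > 0`, and zero otherwise. -/
def Cop (ℓ : ℕ) : PowerSeries (Module.End K (P K)) :=
  PowerSeries.mk fun n => if ℓ ≤ n ∧ 0 < n then (n : K)⁻¹ • Ccoef b ℓ (n - ℓ) else 0

end

end CatalyticOperators

/-!
Write `α = 1 + b`, `X = Y₊`, and let `ι` be multiplication by `y₀`. The operator `Γ_Y` factors as
`X ∘ G`, where `G` (`lax`) is the Lax operator of Nazarov and Sklyanin. In the parameter `u`, put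
`Z(u) = X (G + u)`, so that `ℬ_n(u) = Θ Z(u)ⁿ ι / α`.

With `F(t, u) = ∑_{n ≥ 1} tⁿ ℬ_n(u) / n` one has `𝒞_ℓ = [u^ℓ] F`, and the commutation relations
say exactly that the curvature `Φ(u, v) = [F(u), F(v)] - F'(v) + F'(u)` vanishes, the prime being
the derivative in `u` or `v`. There are operators `e₀, e₁, e₂` on `𝒫`, namely `e₀ = p₁ / α`,
`e₁ = [D, e₀]` and `e₂ = [D, e₁]` with `D` the Laplace–Beltrami operator, such that
`ℬ₁(u) = e₁ + u e₀` and (`B_relations`)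

* `[e₁ + u e₀, ℬ_n(u)] = 0`,
* `[e₂ + u e₁, ℬ_n(u)] = n ℬ_{n+1}(u)`.

These two families and their derivatives in `u` imply, by the Jacobi identity alone
(`curvature_deriv`),
`∂Φ/∂t = [e₂ + (u + v) e₁ + u v e₀, Φ]`.
As `Φ` vanishes at `t = 0`, it vanishes identically (`zero_curvature`).

To prove the two relations, the operators `e₀`, `e₁` and `D` are lifted to operators on `𝒫_Y` which
intertwine with `ι` and `Θ` (`Lifts`). The commutators of the lifts with `X` and `G` are simple:
`[D, X] = X G`, `[D, G] = 0`, `[e₁, X] = X²`, `[G, e₁] = X G`, `[e₀, X] = 0`, `[G, e₀] = X`. So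
`β = e₁ + u e₀` commutes with `Z`, and `[[D, β], Z] = Z²` (`pencil_lie_pow`). The two identities
for `G` with the lifts of `e₁` and `D` are reduced, by means of `[G, X] = (ι Θ + b) X`, to their
values on `y₀ 𝒫`, because an operator which commutes with `X` and kills `y₀ 𝒫` is zero
(`eq_zero_of_commute_shift`). On `y₀ 𝒫` the operator `G` is `α` times the gradient
`∑ y_i i ∂/∂p_i`, and what remains are the identities `grad_euler` and `laplaceY_grad`.
-/

namespace CatalyticOperators

noncomputable section

open Finset

/-! ### The Lax operator on `𝒫_Y` -/

section

variable {K : Type*} [Field K]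

/-- The power sum `p_k`, with the convention `p₀ = 0`, which removes boundary terms from sums over
`antidiagonal`. -/
def psum (K : Type*) [Field K] (k : ℕ) : P K :=
  if h : 0 < k then MvPolynomial.X (⟨k, h⟩ : ℕ+) else 0

@[simp] theorem psum_zero : psum K 0 = 0 := by simp [psum]

@[simp] theorem psum_coe (i : ℕ+) : psum K (i : ℕ) = MvPolynomial.X i := by
  rw [psum, dif_pos i.pos]; rfl

/-- The basis vector `y_k` of the `𝒫`-module `𝒫_Y`. -/
def yvar (K : Type*) [Field K] (k : ℕ) : PY K := Finsupp.single k 1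

theorem single_eq_smul_yvar (k : ℕ) (f : P K) : (Finsupp.single k f : PY K) = f • yvar K k := by
  simp [yvar]

theorem mulY_apply (k : ℕ) (f : P K) : mulY K k f = f • yvar K k := by
  simp [mulY, yvar]

theorem linearMap_ext_smul_yvar {M : Type*} [AddCommMonoid M] [Module K M] {S T : PY K →ₗ[K] M}
    (h : ∀ k (f : P K), S (f • yvar K k) = T (f • yvar K k)) : S = T := by
  refine Finsupp.lhom_ext fun k f => ?_
  rw [single_eq_smul_yvar, h]

/-- The linear map on `𝒫_Y` given by `T k` on the summand `y_k 𝒫`. -/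
def liftY {M : Type*} [AddCommMonoid M] [Module K M] (T : ℕ → P K →ₗ[K] M) : PY K →ₗ[K] M :=
  Finsupp.lsum ℕ T

theorem liftY_smul_yvar {M : Type*} [AddCommMonoid M] [Module K M] (T : ℕ → P K →ₗ[K] M)
    (k : ℕ) (f : P K) : liftY T (f • yvar K k) = T k f := by
  rw [← single_eq_smul_yvar, liftY, Finsupp.lsum_single]

/-- The `k`-th power of `Y₊`, as a `𝒫`-linear map. -/
def shift (k : ℕ) : PY K →ₗ[P K] PY K := Finsupp.lmapDomain (P K) (P K) (· + k)

@[simp] theorem shift_yvar (k j : ℕ) : shift k (yvar K j) = yvar K (j + k) := by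
  simp [shift, yvar]

/-- The operator `∑ y_i i ∂/∂y_i`. -/
def degY : PY K →ₗ[P K] PY K := Finsupp.lsum ℕ fun k => (k : P K) • Finsupp.lsingle k

@[simp] theorem degY_yvar (k : ℕ) : degY (yvar K k) = (k : P K) • yvar K k := by
  simp [degY, yvar]

/-- The operator `Θ_Y`, as a `𝒫`-linear map. -/
def theta : PY K →ₗ[P K] P K := Finsupp.linearCombination (P K) (psum K)

@[simp] theorem theta_yvar (k : ℕ) : theta (yvar K k) = psum K k := by
  simp [theta, yvar]

theorem linearMap_ext_yvar {M : Type*} [AddCommMonoid M] [Module (P K) M] {S T : PY K →ₗ[P K] M}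
    (h : ∀ k, S (yvar K k) = T (yvar K k)) : S = T :=
  Finsupp.lhom_ext' fun k => LinearMap.ext_ring (h k)

theorem shift_shift (i j : ℕ) (x : PY K) : shift i (shift j x) = shift (j + i) x := by
  have : (shift i ∘ₗ shift j : PY K →ₗ[P K] PY K) = shift (j + i) :=
    linearMap_ext_yvar fun k => by simp [add_assoc]
  exact LinearMap.congr_fun this x

theorem degY_shift (i : ℕ) (x : PY K) :
    degY (shift i x) = shift i (degY x) + (i : P K) • shift i x := by
  have : (degY ∘ₗ shift i : PY K →ₗ[P K] PY K) = shift i ∘ₗ degY + (i : P K) • shift i :=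
    linearMap_ext_yvar fun k => by simp [add_smul]
  exact LinearMap.congr_fun this x

/-- The gradient `f ↦ ∑ y_i i ∂f/∂p_i`. -/
def grad : Derivation K (P K) (PY K) :=
  MvPolynomial.mkDerivation K fun i => ((i : ℕ) : P K) • yvar K i

@[simp] theorem grad_psum (k : ℕ) : grad (psum K k) = (k : P K) • yvar K k := by
  rcases Nat.eq_zero_or_pos k with rfl | h
  · simp
  · lift k to ℕ+ using h
    rw [psum_coe, grad, MvPolynomial.mkDerivation_X]

/-- The extension of an operator on `𝒫` to `𝒫_Y` which acts on the coefficients of the `y_i`. -/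
def mapCoeff (T : P K →ₗ[K] P K) : PY K →ₗ[K] PY K := Finsupp.mapRange.linearMap T

@[simp] theorem mapCoeff_smul_yvar (T : P K →ₗ[K] P K) (k : ℕ) (f : P K) :
    mapCoeff T (f • yvar K k) = T f • yvar K k := by
  rw [← single_eq_smul_yvar, mapCoeff, Finsupp.mapRange.linearMap_apply, Finsupp.mapRange_single,
    single_eq_smul_yvar]

theorem mapCoeff_shift (T : P K →ₗ[K] P K) (i : ℕ) (x : PY K) :
    mapCoeff T (shift i x) = shift i (mapCoeff T x) := by
  have : (mapCoeff T ∘ₗ (shift i).restrictScalars K) = (shift i).restrictScalars K ∘ₗ mapCoeff T :=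
    linearMap_ext_smul_yvar fun k f => by simp
  exact LinearMap.congr_fun this x

/-- The derivation `∑ p_{i+k} i ∂/∂p_i`. -/
def euler (k : ℕ) : Derivation K (P K) (P K) := (theta ∘ₗ shift k).compDer grad

theorem euler_apply (k : ℕ) (f : P K) : euler k f = theta (shift k (grad f)) := rfl

theorem euler_psum (k j : ℕ) : euler k (psum K j) = j * psum K (j + k) := by
  simp [euler_apply]

theorem mapCoeff_derivation_smul (d : Derivation K (P K) (P K)) (f : P K) (x : PY K) :
    mapCoeff (d : P K →ₗ[K] P K) (f • x) = f • mapCoeff (d : P K →ₗ[K] P K) x + d f • x := by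
  induction x using Finsupp.induction_linear with
  | zero => simp
  | add x y hx hy => simp only [smul_add, map_add, hx, hy]; abel
  | single k g =>
    rw [single_eq_smul_yvar, smul_smul, mapCoeff_smul_yvar, mapCoeff_smul_yvar]
    simp only [Derivation.coeFn_coe, Derivation.leibniz, smul_eq_mul, smul_smul]
    module

theorem psum_induction {p : P K → Prop} (h1 : ∀ a, p (MvPolynomial.C a))
    (ha : ∀ f g, p f → p g → p (f + g)) (hm : ∀ (k : ℕ) f, p f → p (psum K k * f)) (f : P K) :
    p f := by
  induction f using MvPolynomial.induction_on with
  | C a => exact h1 a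
  | add f g hf hg => exact ha f g hf hg
  | mul_X f i hf => rw [mul_comm, ← psum_coe]; exact hm _ f hf

/-- The first-order part of `grad ∘ euler k` is `mapCoeff (euler k) ∘ grad`, because second partial
derivatives commute; the rest comes from differentiating the coefficients `p_{i+k}`. -/
theorem grad_euler (k : ℕ) (f : P K) :
    grad (euler k f) = mapCoeff (euler (K := K) k : P K →ₗ[K] P K) (grad f)
      + shift k (degY (grad f)) + (k : P K) • shift k (grad f) := by
  induction f using psum_induction with
  | h1 a => simp [← MvPolynomial.algebraMap_eq]
  | ha f g hf hg => simp only [map_add, hf, hg, smul_add]; abel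
  | hm j f hf =>
    simp only [Derivation.leibniz, map_add, map_smul, mapCoeff_derivation_smul, hf, euler_psum,
      grad_psum, smul_eq_mul, mapCoeff_smul_yvar, degY_yvar, shift_yvar, smul_add,
      Derivation.map_natCast, Derivation.coeFn_coe, zero_smul, smul_zero]
    push_cast
    module

variable (b : K)

/-- The value `G y_k = ∑_{d ≥ 1} p_d y_{k-d} + b k y_k` of the Lax operator at `y_k`. -/
def laxVec (k : ℕ) : PY K :=
  ∑ x ∈ antidiagonal k, psum K x.1 • yvar K x.2 + (b * k) • yvar K k

/-- The Nazarov–Sklyanin Lax operator `G` on `𝒫_Y`, determined by `Γ_Y = Y₊ ∘ G`. On `y_k f` it is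
`(1 + b) Y₊ᵏ (grad f) + f G y_k`. -/
def lax : PY K →ₗ[K] PY K :=
  liftY fun k => (1 + b) • ((shift k).restrictScalars K ∘ₗ (grad (K := K) : P K →ₗ[K] PY K))
    + (LinearMap.toSpanSingleton (P K) (PY K) (laxVec b k)).restrictScalars K

theorem lax_smul_yvar (k : ℕ) (f : P K) :
    lax b (f • yvar K k) = (1 + b) • shift k (grad f) + f • laxVec b k := by
  rw [lax, liftY_smul_yvar]; simp

theorem lax_psum_smul (k : ℕ) (x : PY K) :
    lax b (psum K k • x) = psum K k • lax b x + ((1 + b) * k) • shift k x := by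
  induction x using Finsupp.induction_linear with
  | zero => simp
  | add x y hx hy => simp only [smul_add, map_add, hx, hy]; abel
  | single j g =>
    rw [single_eq_smul_yvar, smul_smul, lax_smul_yvar, lax_smul_yvar]
    simp only [Derivation.leibniz, map_add, map_smul, grad_psum, shift_yvar, smul_add, mul_smul,
      Nat.cast_smul_eq_nsmul]
    rw [LinearMap.map_smul_of_tower, shift_yvar, add_comm k j]
    module

theorem laxVec_succ (k : ℕ) :
    laxVec b (k + 1) = shift 1 (laxVec b k) + psum K (k + 1) • yvar K 0 + b • yvar K (k + 1) := by
  simp only [laxVec, Nat.antidiagonal_succ', sum_cons, sum_map, map_add, map_sum, map_smul,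
    LinearMap.map_smul_of_tower, shift_yvar]
  simp
  module

/-- The commutator of the Lax operator with `Y₊` is `(ι Θ + b) Y₊`: it has rank one over `𝒫` up to
the multiple of `Y₊`. -/
theorem lax_shift (x : PY K) :
    lax b (shift 1 x) = shift 1 (lax b x) + theta (shift 1 x) • yvar K 0 + b • shift 1 x := by
  induction x using Finsupp.induction_linear with
  | zero => simp
  | add x y hx hy => simp only [map_add, hx, hy, smul_add, add_smul]; abel
  | single j g =>
    simp only [single_eq_smul_yvar, map_smul, shift_yvar, lax_smul_yvar, laxVec_succ, map_add,
      shift_shift, theta_yvar, LinearMap.map_smul_of_tower]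
    module

@[simp] theorem lax_smul_yvar_zero (f : P K) : lax b (f • yvar K 0) = (1 + b) • grad f := by
  rw [lax_smul_yvar]
  have : shift 0 (grad f) = grad f := by
    exact Finsupp.mapDomain_id
  simp [this, laxVec]

/-- The vector `∑_{j < k} Y₊^{k-j} G y_j`, in closed form. It is the part of order zero of the
operator `laplaceCorr` on `y_k 𝒫`. -/
def twistVec (k : ℕ) : PY K :=
  ∑ x ∈ antidiagonal k, (x.2 : P K) • psum K x.1 • yvar K x.2 + (b * (k * (k - 1) / 2)) • yvar K k

theorem twistVec_succ [CharZero K] (k : ℕ) :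
    twistVec b (k + 1) = shift 1 (twistVec b k) + shift 1 (laxVec b k) := by
  simp only [laxVec, twistVec, Nat.antidiagonal_succ', sum_cons, sum_map, map_add, map_sum,
    map_smul, LinearMap.map_smul_of_tower, shift_yvar]
  simp [add_smul, sum_add_distrib]
  module

theorem sum_antidiagonal_swap {M : Type*} [AddCommMonoid M] (k : ℕ) (F : ℕ → ℕ → M) :
    ∑ x ∈ antidiagonal k, F x.1 x.2 = ∑ x ∈ antidiagonal k, F x.2 x.1 :=
  (Finset.Nat.sum_antidiagonal_swap (f := fun x => F x.1 x.2)).symm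

theorem grad_theta_twistVec (k : ℕ) :
    grad (theta (twistVec b k)) = (k : P K) • twistVec b k := by
  have h1 : ∑ x ∈ antidiagonal k, (x.2 : P K) • (psum K x.2 • (x.1 : P K) • yvar K x.1)
      = ∑ x ∈ antidiagonal k, (x.1 : P K) • (psum K x.1 • (x.2 : P K) • yvar K x.2) :=
    (sum_antidiagonal_swap k fun d e => (d : P K) • (psum K d • (e : P K) • yvar K e)).symm
  simp only [twistVec, map_add, map_sum, map_smul, LinearMap.map_smul_of_tower, theta_yvar,
    smul_eq_mul, Derivation.leibniz, Derivation.map_smul, grad_psum, Derivation.map_natCast,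
    smul_add, sum_add_distrib, smul_zero, add_zero, h1, smul_sum]
  rw [← sum_add_distrib, smul_comm (k : P K)]
  congr 1
  refine sum_congr rfl fun x hx => ?_
  rw [← mem_antidiagonal.1 hx]
  push_cast
  module

theorem two_mul_theta_twistVec [CharZero K] (k : ℕ) :
    2 * theta (twistVec b k) = k * theta (laxVec b k) - (b * k) • psum K k := by
  have h1 : ∑ x ∈ antidiagonal k, (x.2 : P K) * (psum K x.1 * psum K x.2)
      = ∑ x ∈ antidiagonal k, (x.1 : P K) * (psum K x.1 * psum K x.2) := by
    rw [sum_antidiagonal_swap k fun d e => (e : P K) * (psum K d * psum K e)]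
    exact sum_congr rfl fun x _ => by ring
  have h2 : k * ∑ x ∈ antidiagonal k, psum K x.1 * psum K x.2
      = 2 * ∑ x ∈ antidiagonal k, (x.2 : P K) * (psum K x.1 * psum K x.2) := by
    rw [two_mul]
    nth_rewrite 1 [h1]
    rw [← sum_add_distrib, mul_sum]
    refine sum_congr rfl fun x hx => ?_
    rw [← mem_antidiagonal.1 hx]
    push_cast
    ring
  simp only [twistVec, laxVec, map_add, map_sum, map_smul, LinearMap.map_smul_of_tower, theta_yvar,
    smul_eq_mul, mul_add, h2, Algebra.smul_def]
  have h3 : (2 : P K) * algebraMap K (P K) (b * (k * (k - 1) / 2))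
      = k * algebraMap K (P K) (b * k) - algebraMap K (P K) (b * k) := by
    rw [← map_ofNat (algebraMap K (P K)), ← map_natCast (algebraMap K (P K)), ← map_mul,
      ← map_mul, ← map_sub]
    congr 1
    field
  linear_combination psum K k * h3

/-! ### The Laplace–Beltrami operator and its lift -/

/-- The Laplace–Beltrami operator
`½ (α ∑ p_{i+j} i j ∂_i ∂_j + ∑ p_i p_j (i + j) ∂_{i+j} + b ∑ p_i i (i - 1) ∂_i)` with `α = 1 + b`,
written as `½ Θ (G - b) grad`. -/
def laplace : P K →ₗ[K] P K :=
  (2 : K)⁻¹ • (theta.restrictScalars K ∘ₗ (lax b - b • LinearMap.id) ∘ₗ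
    (grad (K := K) : P K →ₗ[K] PY K))

theorem laplace_apply (f : P K) :
    laplace b f = (2 : K)⁻¹ • (theta (lax b (grad f)) - b • theta (grad f)) := by
  simp [laplace, LinearMap.map_smul_of_tower]

/-- The Laplace–Beltrami operator has order two: its commutator with `p_k` is a derivation plus a
multiplication. -/
theorem laplace_psum_mul [CharZero K] (k : ℕ) (f : P K) :
    laplace b (psum K k * f) = psum K k * laplace b f + ((1 + b) * k) • euler k f
      + theta (twistVec b k) * f := by
  have h2 : algebraMap K (P K) 2⁻¹ * 2 = 1 := by
    rw [← map_ofNat (algebraMap K (P K)), ← map_mul]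
    simp
  have h := two_mul_theta_twistVec b k
  have h1 : f • (k : P K) • yvar K k = (k : K) • f • yvar K k := by
    rw [Nat.cast_smul_eq_nsmul, Nat.cast_smul_eq_nsmul, smul_comm]
  simp only [laplace_apply, Derivation.leibniz, map_add, lax_psum_smul, grad_psum, h1,
    lax_smul_yvar, LinearMap.map_smul_of_tower, map_smul, theta_yvar, ← euler_apply, smul_eq_mul]
  simp only [Algebra.smul_def, map_mul, map_add, map_one, map_natCast] at h ⊢
  linear_combination ((1 + algebraMap K (P K) b) * k * euler k f + theta (twistVec b k) * f) * h2
    - algebraMap K (P K) 2⁻¹ * f * h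

/-- The operator on `𝒫_Y` with value `∑_{j < k} Y₊^{k-j} G (y_j f)` at `y_k f`. -/
def laplaceCorr : PY K →ₗ[K] PY K :=
  liftY fun k => ((1 + b) * k) • ((shift k).restrictScalars K ∘ₗ (grad (K := K) : P K →ₗ[K] PY K))
    + (LinearMap.toSpanSingleton (P K) (PY K) (twistVec b k)).restrictScalars K

/-- The lift of the Laplace–Beltrami operator to `𝒫_Y`. The correction is forced by the relation
`[D, Y₊] = Y₊ G` and by `D y₀ = y₀ D`. -/
def laplaceY : PY K →ₗ[K] PY K := mapCoeff (laplace b) + laplaceCorr b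

theorem laplaceY_smul_yvar (k : ℕ) (f : P K) :
    laplaceY b (f • yvar K k) = laplace b f • yvar K k + ((1 + b) * k) • shift k (grad f)
      + f • twistVec b k := by
  rw [laplaceY, LinearMap.add_apply, mapCoeff_smul_yvar, laplaceCorr, liftY_smul_yvar]
  simp [add_assoc]

theorem laplaceY_shift [CharZero K] (x : PY K) :
    laplaceY b (shift 1 x) = shift 1 (laplaceY b x) + shift 1 (lax b x) := by
  induction x using Finsupp.induction_linear with
  | zero => simp
  | add x y hx hy => simp only [map_add, hx, hy]; abel
  | single j g =>
    simp only [single_eq_smul_yvar, map_smul, shift_yvar, lax_smul_yvar, laplaceY_smul_yvar,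
      map_add, shift_shift, LinearMap.map_smul_of_tower, twistVec_succ]
    push_cast
    module

@[simp] theorem laplaceY_smul_yvar_zero (f : P K) :
    laplaceY b (f • yvar K 0) = laplace b f • yvar K 0 := by
  rw [laplaceY_smul_yvar]
  simp [twistVec]

theorem theta_laplaceY [CharZero K] (x : PY K) :
    theta (laplaceY b x) = laplace b (theta x) := by
  induction x using Finsupp.induction_linear with
  | zero => simp
  | add x y hx hy => simp only [map_add, hx, hy]
  | single j g =>
    simp only [single_eq_smul_yvar, map_smul, laplaceY_smul_yvar, map_add, theta_yvar, smul_eq_mul,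
      mul_comm g (psum K j), laplace_psum_mul, LinearMap.map_smul_of_tower, euler_apply]
    simp only [Algebra.smul_def]
    ring

theorem laplaceY_psum_smul [CharZero K] (k : ℕ) (x : PY K) :
    laplaceY b (psum K k • x) = psum K k • laplaceY b x
      + ((1 + b) * k) • (mapCoeff (euler (K := K) k : P K →ₗ[K] P K) x + shift k (degY x))
      + theta (twistVec b k) • x := by
  induction x using Finsupp.induction_linear with
  | zero => simp
  | add x y hx hy => simp only [smul_add, map_add, hx, hy]; abel
  | single j g =>
    simp only [single_eq_smul_yvar, smul_smul, laplaceY_smul_yvar, laplace_psum_mul,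
      mapCoeff_smul_yvar, map_smul, degY_yvar, shift_yvar, Derivation.leibniz, map_add, grad_psum,
      smul_add, Derivation.coeFn_coe, add_smul, smul_assoc]
    rw [add_comm k j]
    module

theorem laplaceY_grad [CharZero K] (f : P K) : laplaceY b (grad f) = grad (laplace b f) := by
  induction f using psum_induction with
  | h1 a => simp [← MvPolynomial.algebraMap_eq, laplace_apply]
  | ha f g hf hg => simp only [map_add, hf, hg]
  | hm k f hf =>
    simp only [laplace_psum_mul, Derivation.leibniz, map_add, laplaceY_psum_smul, hf, grad_psum,
      Derivation.map_smul, grad_euler, grad_theta_twistVec]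
    have h1 : f • (k : P K) • yvar K k = (k : P K) • f • yvar K k := smul_comm _ _ _
    rw [h1, Nat.cast_smul_eq_nsmul (P K) k (f • yvar K k), map_nsmul, laplaceY_smul_yvar,
      ← Nat.cast_smul_eq_nsmul (P K)]
    simp only [smul_add, Nat.cast_smul_eq_nsmul]
    module

/-- As the `y_k 𝒫` are the images of `y₀ 𝒫` under the powers of `Y₊`, an operator which commutes
with `Y₊` is determined by its values on `y₀ 𝒫`. -/
theorem eq_zero_of_commute_shift {T : PY K →ₗ[K] PY K} (h0 : ∀ f : P K, T (f • yvar K 0) = 0)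
    (h : ∀ x, T (shift 1 x) = shift 1 (T x)) : T = 0 := by
  refine linearMap_ext_smul_yvar fun k => ?_
  induction k with
  | zero => exact h0
  | succ k ih =>
    intro f
    rw [← shift_yvar, ← map_smul, h, ih]
    simp

/-- The commutator of the two operators commutes with `Y₊`, because `laplaceY` commutes with `ι Θ`.
It kills `y₀ 𝒫` by `laplaceY_grad`. -/
theorem laplaceY_lax [CharZero K] (x : PY K) :
    laplaceY b (lax b x) = lax b (laplaceY b x) := by
  have : laplaceY b ∘ₗ lax b - lax b ∘ₗ laplaceY b = 0 := by
    refine eq_zero_of_commute_shift (fun f => ?_) fun x => ?_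
    · simp [laplaceY_grad]
    · simp only [LinearMap.sub_apply, LinearMap.comp_apply, lax_shift, laplaceY_shift, map_add,
        laplaceY_smul_yvar_zero, LinearMap.map_smul_of_tower, map_sub]
      have := theta_laplaceY b (shift 1 x)
      rw [laplaceY_shift, map_add] at this
      rw [← this]
      module
  exact sub_eq_zero.1 (LinearMap.congr_fun this x)

/-- The lift `∑ p_{i+1} i ∂/∂p_i + ∑ y_{i+1} i ∂/∂y_i` to `𝒫_Y` of `euler 1`. -/
def raise : PY K →ₗ[K] PY K :=
  mapCoeff (euler (K := K) 1 : P K →ₗ[K] P K) + (shift 1 ∘ₗ degY).restrictScalars K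

theorem raise_smul_yvar (k : ℕ) (f : P K) :
    raise (f • yvar K k) = euler 1 f • yvar K k + (k * f) • yvar K (k + 1) := by
  simp [raise, smul_smul, mul_comm]

theorem raise_shift (x : PY K) :
    raise (shift 1 x) = shift 1 (raise x) + shift 1 (shift 1 x) := by
  simp [raise, mapCoeff_shift, degY_shift, add_assoc]

theorem theta_raise (x : PY K) : theta (raise x) = euler 1 (theta x) := by
  induction x using Finsupp.induction_linear with
  | zero => simp
  | add x y hx hy => simp only [map_add, hx, hy]
  | single j g =>
    simp only [single_eq_smul_yvar, raise_smul_yvar, map_add, map_smul, theta_yvar, smul_eq_mul,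
      Derivation.leibniz, euler_psum]
    ring

@[simp] theorem raise_smul_yvar_zero (f : P K) : raise (f • yvar K 0) = euler 1 f • yvar K 0 := by
  simp [raise_smul_yvar]

/-- The difference of the two sides commutes with `Y₊`, and it kills `y₀ 𝒫` by `grad_euler`. -/
theorem lax_raise (x : PY K) :
    lax b (raise x) = raise (lax b x) + shift 1 (lax b x) := by
  have : lax b ∘ₗ raise - raise ∘ₗ lax b - (shift 1).restrictScalars K ∘ₗ lax b = 0 := by
    refine eq_zero_of_commute_shift (fun f => ?_) fun x => ?_
    · simp [grad_euler, raise]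
    · simp only [LinearMap.sub_apply, LinearMap.comp_apply, lax_shift, raise_shift, map_add,
        raise_smul_yvar_zero, LinearMap.map_smul_of_tower, map_sub, LinearMap.restrictScalars_apply]
      have := theta_raise (shift 1 x)
      rw [raise_shift, map_add] at this
      rw [← this]
      simp
      module
  exact sub_eq_zero.1 ((sub_sub _ _ _).symm.trans (LinearMap.congr_fun this x))

end

/-! ### The operators `Y₊`, `Θ_Y` and `Γ_Y` on basis vectors -/

section

variable {K : Type*} [Field K]

theorem dY_smul_yvar (i k : ℕ) (f : P K) : dY K i (f • yvar K k) = if i = k then f else 0 := by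
  rw [← single_eq_smul_yvar]
  simp [dY, Finsupp.single_apply, eq_comm]

theorem Yplus_apply (x : PY K) : Yplus K x = shift 1 x := by
  have : Yplus K = (shift 1).restrictScalars K := linearMap_ext_smul_yvar fun k f => by
    change ∑ᶠ i, mulY K (i + 1) (dY K i (f • yvar K k)) = _
    rw [finsum_eq_single _ k fun i hi => by simp [dY_smul_yvar, hi]]
    simp [dY_smul_yvar, mulY_apply]
  exact LinearMap.congr_fun this x

theorem Theta_apply (x : PY K) : Theta K x = theta x := by
  have : Theta K = theta.restrictScalars K := linearMap_ext_smul_yvar fun k f => by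
    change ∑ᶠ i : ℕ+, mulP K i (dY K i (f • yvar K k)) = _
    rcases Nat.eq_zero_or_pos k with rfl | h
    · rw [finsum_eq_zero_of_forall_eq_zero fun i => by simp [dY_smul_yvar]]
      simp
    · lift k to ℕ+ using h
      rw [finsum_eq_single _ k fun i hi => by simp [dY_smul_yvar, hi]]
      simp [dY_smul_yvar, mulP, mul_comm]
  exact LinearMap.congr_fun this x

theorem gammaTwist_smul_yvar (k : ℕ) (f : P K) :
    gammaTwist K (f • yvar K k) = (k : K) • f • yvar K (k + 1) := by
  change ∑ᶠ i : ℕ+, mulY K (i + 1) (((i : ℕ) : K) • dY K i (f • yvar K k)) = _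
  rcases Nat.eq_zero_or_pos k with rfl | h
  · rw [finsum_eq_zero_of_forall_eq_zero fun i => by simp [dY_smul_yvar]]
    simp
  · lift k to ℕ+ using h
    rw [finsum_eq_single _ k fun i hi => by simp [dY_smul_yvar, hi]]
    simp [dY_smul_yvar, mulY_apply]

theorem gammaCut_smul_yvar (k : ℕ) (f : P K) :
    gammaCut K (f • yvar K k) = ∑ x ∈ antidiagonal k, f • psum K x.1 • yvar K (x.2 + 1) := by
  change ∑ᶠ ij : ℕ+ × ℕ+,
    mulY K ij.1 (mulP K ij.2 (dY K ((ij.1 : ℕ) + ij.2 - 1) (f • yvar K k))) = _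
  have hne (i j : ℕ) (h : i + 1 + j ≠ k) : dY K (i + 1 + j) (f • yvar K k) = 0 := by
    simp [dY_smul_yvar, h]
  -- Indexing by `(j - 1, i - 1)`, the nonzero terms are those of the antidiagonal of `k - 1`.
  rw [← finsum_comp_equiv (Equiv.prodComm _ _),
    ← finsum_comp_equiv (Equiv.pnatEquivNat.symm.prodCongr Equiv.pnatEquivNat.symm)]
  cases k with
  | zero =>
    rw [finsum_eq_zero_of_forall_eq_zero]
    · simp
    · rintro ⟨j, i⟩
      simp [dY_smul_yvar]
  | succ m =>
    rw [finsum_eq_sum_of_support_subset (s := antidiagonal m), Nat.antidiagonal_succ]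
    · rw [sum_cons, sum_map]
      simp only [psum_zero, zero_smul, smul_zero, zero_add]
      refine sum_congr rfl fun x hx => ?_
      have : x.2 + 1 + (x.1 + 1) - 1 = m + 1 := by
        have := mem_antidiagonal.1 hx
        omega
      simp [dY_smul_yvar, this, mulY_apply, mulP, psum, smul_smul, mul_comm, Nat.succPNat]
    · rintro ⟨j, i⟩ h
      rw [mem_coe, HasAntidiagonal.mem_antidiagonal]
      by_contra h'
      refine h ?_
      have := hne i j (by omega)
      simp [this]

theorem derivation_sum_apply {ι M : Type*} [AddCommMonoid M] [Module K M] [Module (P K) M]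
    (s : Finset ι) (d : ι → Derivation K (P K) M) (f : P K) :
    (∑ i ∈ s, d i) f = ∑ i ∈ s, d i f := by
  have := congr_fun (map_sum (Derivation.coeFnAddMonoidHom (R := K) (A := P K) (M := M)) d s) f
  rw [Finset.sum_apply] at this
  exact this

theorem grad_eq_sum_vars (f : P K) :
    grad f = ∑ i ∈ f.vars, (((i : ℕ) : K) • dP K i f) • yvar K i := by
  have h : grad f = (∑ i ∈ f.vars, (LinearMap.toSpanSingleton (P K) (PY K)
      (((i : ℕ) : P K) • yvar K i)).compDer (MvPolynomial.pderiv i) :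
        Derivation K (P K) (PY K)) f := by
    refine MvPolynomial.derivation_eq_of_forall_mem_vars fun j hj => ?_
    rw [derivation_sum_apply, sum_eq_single_of_mem j hj fun i _ hij => by
      simp [MvPolynomial.pderiv_X_of_ne hij.symm]]
    rw [← psum_coe, grad_psum]
    simp
  rw [h, derivation_sum_apply]
  refine sum_congr rfl fun i _ => ?_
  change MvPolynomial.pderiv i f • ((i : ℕ) : P K) • yvar K i
    = (((i : ℕ) : K) • MvPolynomial.pderiv i f) • yvar K i
  rw [smul_assoc, Nat.cast_smul_eq_nsmul, Nat.cast_smul_eq_nsmul, smul_comm]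

theorem gammaJoin_smul_yvar (k : ℕ) (f : P K) :
    gammaJoin K (f • yvar K k) = shift (k + 1) (grad f) := by
  change ∑ᶠ ij : ℕ+ × ℕ+, mulY K ((ij.1 : ℕ) + ij.2)
    (((ij.1 : ℕ) : K) • dP K ij.1 (dY K ((ij.2 : ℕ) - 1) (f • yvar K k))) = _
  rw [finsum_eq_sum_of_support_subset (s := f.vars ×ˢ {k.succPNat}), sum_product]
  · simp [dY_smul_yvar, mulY_apply, grad_eq_sum_vars]
  · rintro ⟨i, j⟩ h
    by_contra h'
    refine h ?_
    rw [coe_product, Set.mem_prod, not_and_or] at h'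
    rcases h' with h' | h'
    · have : dP K i f = 0 := MvPolynomial.pderiv_eq_zero_of_notMem_vars h'
      simp only [dY_smul_yvar]
      split_ifs <;> simp [this]
    · have : (j : ℕ) - 1 ≠ k := fun e => h' (by
        have := j.pos
        simp only [coe_singleton, Set.mem_singleton_iff]
        exact PNat.eq (by simp; omega))
      simp [dY_smul_yvar, this]

theorem Gamma_apply (b : K) (x : PY K) : Gamma b x = shift 1 (lax b x) := by
  have : Gamma b = (shift 1).restrictScalars K ∘ₗ lax b := linearMap_ext_smul_yvar fun k f => by
    simp only [Gamma, LinearMap.add_apply, LinearMap.smul_apply, gammaJoin_smul_yvar,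
      gammaCut_smul_yvar, gammaTwist_smul_yvar, LinearMap.comp_apply, lax_smul_yvar, laxVec,
      LinearMap.restrictScalars_apply, map_add, map_sum, map_smul, LinearMap.map_smul_of_tower,
      shift_yvar, shift_shift, ← smul_sum]
    module
  exact LinearMap.congr_fun this x

end

/-! ### Zero curvature from linear differential equations -/

section

open PowerSeries

attribute [local instance] LieRing.ofAssociativeRing

/-- The differential equation of the curvature: with `∂f = [e₂ + u e₁, f] + e₁ + u e₀`, the left
side is the derivative in `t` of `[f, g] - g' + f'`. The elements `f'` and `g'` are arbitrary subject to
the equations obtained by formally differentiating those of `f` and `g` in `u` and `v`. -/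
theorem curvature_deriv {k L : Type*} [CommRing k] [LieRing L] [LieAlgebra k L] (u v : k)
    {e₀ e₁ e₂ f g f' g' : L}
    (hf : ⁅e₁ + u • e₀, f⁆ = 0) (hg : ⁅e₁ + v • e₀, g⁆ = 0)
    (hf' : ⁅e₁ + u • e₀, f'⁆ = -⁅e₀, f⁆) (hg' : ⁅e₁ + v • e₀, g'⁆ = -⁅e₀, g⁆) :
    ⁅⁅e₂ + u • e₁, f⁆ + (e₁ + u • e₀), g⁆ + ⁅f, ⁅e₂ + v • e₁, g⁆ + (e₁ + v • e₀)⁆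
      - (⁅e₂ + v • e₁, g'⁆ + ⁅e₁, g⁆ + e₀) + (⁅e₂ + u • e₁, f'⁆ + ⁅e₁, f⁆ + e₀)
      = ⁅e₂ + (u + v) • e₁ + (u * v) • e₀, ⁅f, g⁆ - g' + f'⁆ := by
  rw [add_lie, smul_lie] at hf hg hf' hg'
  rw [add_eq_zero_iff_eq_neg] at hf hg
  rw [← eq_sub_iff_add_eq] at hf' hg'
  have h1 : ⁅f, e₁⁆ = -⁅e₁, f⁆ := (lie_skew _ _).symm
  have h0 : ⁅f, e₀⁆ = -⁅e₀, f⁆ := (lie_skew _ _).symm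
  simp only [add_lie, lie_add, smul_lie, lie_smul, lie_sub, leibniz_lie e₂ f g,
    leibniz_lie e₁ f g, leibniz_lie e₀ f g, h1, h0, hf, hg, hf', hg', neg_lie, lie_neg]
  module

/-- The derivative in the central variable of a power series over a possibly noncommutative ring. -/
def seriesDeriv {A : Type*} [Ring A] : A⟦X⟧ →+ A⟦X⟧ where
  toFun F := PowerSeries.mk fun n => (n + 1 : A) * coeff (n + 1) F
  map_zero' := by ext; simp
  map_add' F G := by ext; simp [mul_add]

theorem coeff_seriesDeriv {A : Type*} [Ring A] (F : A⟦X⟧) (n : ℕ) :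
    coeff n (seriesDeriv F) = (n + 1 : A) * coeff (n + 1) F := by
  simp [seriesDeriv]

theorem seriesDeriv_mul {A : Type*} [Ring A] (F G : A⟦X⟧) :
    seriesDeriv (F * G) = seriesDeriv F * G + F * seriesDeriv G := by
  ext n
  have h1 : ∑ x ∈ antidiagonal (n + 1), (x.1 : A) * (coeff x.1 F * coeff x.2 G)
      = ∑ x ∈ antidiagonal n, (x.1 + 1 : A) * coeff (x.1 + 1) F * coeff x.2 G := by
    rw [Nat.antidiagonal_succ, sum_cons, sum_map]
    simp [mul_assoc]
  have h2 : ∑ x ∈ antidiagonal (n + 1), (x.2 : A) * (coeff x.1 F * coeff x.2 G)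
      = ∑ x ∈ antidiagonal n, coeff x.1 F * ((x.2 + 1 : A) * coeff (x.2 + 1) G) := by
    rw [Nat.antidiagonal_succ', sum_cons, sum_map]
    simp only [Nat.cast_zero, zero_mul, zero_add]
    refine sum_congr rfl fun x _ => ?_
    rw [← mul_assoc, (Nat.cast_commute _ _).eq, mul_assoc]
    simp
  simp only [map_add, coeff_mul, coeff_seriesDeriv]
  rw [← h1, ← h2, ← sum_add_distrib, mul_sum]
  refine sum_congr rfl fun x hx => ?_
  rw [← add_mul, ← Nat.cast_add, mem_antidiagonal.1 hx]
  simp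

theorem seriesDeriv_lie {A : Type*} [Ring A] (F G : A⟦X⟧) :
    seriesDeriv ⁅F, G⁆ = ⁅seriesDeriv F, G⁆ + ⁅F, seriesDeriv G⁆ := by
  simp only [Ring.lie_def, map_sub, seriesDeriv_mul]
  abel

theorem eq_zero_of_seriesDeriv_eq_lie {A : Type*} [Ring A] [IsAddTorsionFree A] {E F : A⟦X⟧}
    (h0 : coeff 0 F = 0) (h : seriesDeriv F = ⁅E, F⁆) : F = 0 := by
  ext n
  induction n using Nat.strong_induction_on with
  | _ n ih =>
    cases n with
    | zero => simpa using h0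
    | succ n =>
      have h1 : coeff n ⁅E, F⁆ = 0 := by
        rw [Ring.lie_def, map_sub, coeff_mul, coeff_mul, sum_eq_zero, sum_eq_zero, sub_zero]
        · intro x hx
          rw [ih x.1 (by have := mem_antidiagonal.1 hx; omega)]; simp
        · intro x hx
          rw [ih x.2 (by have := mem_antidiagonal.1 hx; omega)]; simp
      rw [← h, coeff_seriesDeriv] at h1
      have h2 : (n + 1) • coeff (n + 1) F = 0 := by
        rw [nsmul_eq_mul]; exact_mod_cast h1
      exact (smul_eq_zero_iff_right n.succ_ne_zero).1 h2

/-- The differential equation and the initial value of the curvature force it to vanish, by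
induction on the power of `t`. The parameters `u` and `v` lie in the
centre, so that `A⟦X⟧` is a Lie algebra over a commutative ring that contains them. -/
theorem zero_curvature {A : Type*} [Ring A] [IsAddTorsionFree A] (u v : Subring.center A⟦X⟧)
    {e₀ e₁ e₂ f g f' g' : A⟦X⟧}
    (hf : ⁅e₁ + u • e₀, f⁆ = 0) (hg : ⁅e₁ + v • e₀, g⁆ = 0)
    (hf' : ⁅e₁ + u • e₀, f'⁆ = -⁅e₀, f⁆) (hg' : ⁅e₁ + v • e₀, g'⁆ = -⁅e₀, g⁆)
    (df : seriesDeriv f = ⁅e₂ + u • e₁, f⁆ + (e₁ + u • e₀))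
    (dg : seriesDeriv g = ⁅e₂ + v • e₁, g⁆ + (e₁ + v • e₀))
    (df' : seriesDeriv f' = ⁅e₂ + u • e₁, f'⁆ + ⁅e₁, f⁆ + e₀)
    (dg' : seriesDeriv g' = ⁅e₂ + v • e₁, g'⁆ + ⁅e₁, g⁆ + e₀)
    (f0 : coeff 0 f = 0) (f0' : coeff 0 f' = 0) (g0' : coeff 0 g' = 0) :
    ⁅f, g⁆ = g' - f' := by
  have h : ⁅f, g⁆ - g' + f' = 0 := by
    refine eq_zero_of_seriesDeriv_eq_lie (E := e₂ + (u + v) • e₁ + (u * v) • e₀) ?_ ?_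
    · rw [map_add, map_sub, f0', g0', Ring.lie_def, map_sub, coeff_mul, coeff_mul]
      simp_all
    · rw [← curvature_deriv u v hf hg hf' hg', map_add, map_sub, seriesDeriv_lie, df, dg, df', dg']
  rw [← sub_eq_zero, ← h]
  abel

end

/-! ### Operators depending linearly on `u` -/

open Polynomial

/-- The polynomial `a + u a'` in a central variable `u`. -/
def pencil {A : Type*} [Ring A] (a a' : A) : A[X] := C a + X * C a'

/-- Here `r + u q` is the element `β`, which satisfies `[g + u, β] = x (g + u)`, and it follows that
`β` commutes with `Z = x (g + u)`. Since `[d, Z] = Z g`, the Jacobi identity gives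
`[[d, β], Z] = -[β, Z g] = Z [g, β] = Z²`. -/
theorem pencil_lie_pow {A : Type*} [Ring A] {x g r q d : A}
    (hrx : ⁅r, x⁆ = x * x) (hqx : ⁅q, x⁆ = 0) (hrg : ⁅g, r⁆ = x * g) (hqg : ⁅g, q⁆ = x)
    (hdx : ⁅d, x⁆ = x * g) (hdg : ⁅d, g⁆ = 0) (n : ℕ) :
    ⁅pencil r q, pencil (x * g) x ^ n⁆ = 0 ∧
    ⁅pencil ⁅d, r⁆ ⁅d, q⁆, pencil (x * g) x ^ n⁆ = n • pencil (x * g) x ^ (n + 1) := by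
  have hX (y : A[X]) : X * y = y * X := (commute_X y).eq
  -- The constants are made opaque, so that `noncomm_ring` treats them as atoms.
  obtain ⟨x', hx'⟩ : ∃ y : A[X], y = C x := ⟨_, rfl⟩
  obtain ⟨g', hg'⟩ : ∃ y : A[X], y = C g + X := ⟨_, rfl⟩
  obtain ⟨g'', hg''⟩ : ∃ y : A[X], y = C g := ⟨_, rfl⟩
  obtain ⟨d', hd'⟩ : ∃ y : A[X], y = C d := ⟨_, rfl⟩
  obtain ⟨β, hβ⟩ : ∃ y : A[X], y = pencil r q := ⟨_, rfl⟩
  have hZ : pencil (x * g) x = x' * g' := by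
    rw [pencil, hx', hg', mul_add, C_mul, hX]
  have hE : pencil ⁅d, r⁆ ⁅d, q⁆ = d' * β - β * d' := by
    have h := hX (C d)
    simp only [Ring.lie_def, pencil, hβ, hd', C_sub, C_mul, mul_add, add_mul, mul_sub, mul_assoc]
    rw [← mul_assoc (C d) X, ← h]
    simp only [mul_assoc]
    abel
  rw [Ring.lie_def, sub_eq_iff_eq_add] at hrx hqx hrg hqg hdx hdg
  have h1 : β * x' = x' * x' + x' * β := by
    rw [hβ, hx', pencil, add_mul, mul_add, ← C_mul, hrx, hX (C q), mul_assoc, hX (C x), ← mul_assoc,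
      ← C_mul, hqx, C_add, C_mul, C_mul, zero_add, C_mul, mul_assoc (C x) (C q), add_assoc]
  have h2 : g'' * β = x' * g' + β * g'' := by
    rw [hβ, hg'', hx', hg', pencil, mul_add, add_mul, mul_add, ← C_mul, hrg, hX (C q),
      ← mul_assoc, ← C_mul, hqg, mul_assoc, hX (C g), ← mul_assoc]
    simp only [C_add, C_mul, add_mul]
    abel
  have h3 : d' * x' = x' * g'' + x' * d' := by
    rw [hd', hx', hg'', ← C_mul, hdx, C_add, C_mul, C_mul]
  have h4 : d' * g'' = g'' * d' := by
    rw [hd', hg'', ← C_mul, hdg, zero_add, C_mul]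
  have h5 : g' = g'' + X := by rw [hg', hg'']
  have h6 : g'' * g' = g' * g'' := by
    rw [h5, mul_add, add_mul, hX]
  have h7 : g' * β = x' * g' + β * g' := by
    rw [h5, add_mul, mul_add, h2, h5, hX β]
    noncomm_ring
  have h8 : d' * g' = g' * d' := by
    rw [h5, mul_add, add_mul, h4, hX d']
  rw [hZ, hE, ← hβ]
  have hβZ : Commute β (x' * g') := by
    change β * (x' * g') = x' * g' * β
    rw [mul_assoc, h7, ← mul_assoc, h1]
    noncomm_ring
  have hEZ : (d' * β - β * d') * (x' * g') = x' * g' * (d' * β - β * d') + x' * g' * (x' * g') := by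
    have hdZ : d' * (x' * g') = x' * g' * d' + x' * g' * g'' := by
      rw [← mul_assoc, h3, add_mul, mul_assoc, h6, mul_assoc x' d', h8]
      noncomm_ring
    generalize x' * g' = Z at hβZ h2 hdZ ⊢
    have h9 : β * (d' * Z) = Z * β * d' + Z * β * g'' := by
      rw [hdZ, mul_add, ← mul_assoc, ← mul_assoc, hβZ.eq]
    rw [sub_mul, mul_assoc, mul_assoc, h9, hβZ.eq, ← mul_assoc, hdZ, add_mul, mul_assoc Z g'' β, h2]
    noncomm_ring
  refine ⟨?_, ?_⟩
  · rw [Ring.lie_def, sub_eq_zero]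
    exact hβZ.pow_right n
  · generalize d' * β - β * d' = E at hEZ ⊢
    generalize x' * g' = Z at hEZ ⊢
    rw [Ring.lie_def]
    induction n with
    | zero => simp
    | succ n ih =>
      rw [sub_eq_iff_eq_add] at ih ⊢
      rw [pow_succ, ← mul_assoc, ih, add_mul, mul_assoc, hEZ, mul_add, smul_mul_assoc, add_smul,
        pow_succ _ (n + 1), pow_succ]
      noncomm_ring

/-! ### Transfer from `𝒫_Y` to `𝒫` -/

section

variable {K : Type*} [Field K] (b : K)

/-- The map `T ↦ Θ_Y T (y₀ / (1 + b))` from operators on `𝒫_Y` to operators on `𝒫`. -/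
def compress : Module.End K (PY K) →ₗ[K] Module.End K (P K) where
  toFun T := Theta K ∘ₗ T ∘ₗ ((1 + b)⁻¹ • mulY K 0)
  map_add' S T := by rw [LinearMap.add_comp, LinearMap.comp_add]
  map_smul' c T := by rw [LinearMap.smul_comp, LinearMap.comp_smul]; rfl

/-- The map `compress`, applied to the coefficients of a polynomial in `u`. -/
def compressPoly : (Module.End K (PY K))[X] →+ (Module.End K (P K))[X] where
  toFun p := p.sum fun r T => monomial r (compress b T)
  map_zero' := by simp
  map_add' p q := by
    rw [sum_add_index] <;> simp

theorem coeff_compressPoly (p : (Module.End K (PY K))[X]) (n : ℕ) :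
    (compressPoly b p).coeff n = compress b (p.coeff n) := by
  change (p.sum fun r T => monomial r (compress b T)).coeff n = _
  rw [Polynomial.sum_def, finsetSum_coeff]
  simp only [coeff_monomial]
  rw [sum_ite_eq']
  split_ifs with h
  · rfl
  · rw [notMem_support_iff.1 h, map_zero]

theorem B_eq_compressPoly (n : ℕ) : B b n = compressPoly b (pencil (Gamma b) (Yplus K) ^ n) := rfl

/-- The operator `A` on `𝒫_Y` lifts the operator `a` on `𝒫`, in the sense that the two are
intertwined by `Θ_Y` and by multiplication by `y₀`. Then `compress` turns the commutator with `A`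
into the commutator with `a`. -/
structure Lifts (a : Module.End K (P K)) (A : Module.End K (PY K)) : Prop where
  theta : Theta K ∘ₗ A = a ∘ₗ Theta K
  mulY : A ∘ₗ CatalyticOperators.mulY K 0 = CatalyticOperators.mulY K 0 ∘ₗ a

theorem Lifts.lie {a a' : Module.End K (P K)} {A A' : Module.End K (PY K)} (h : Lifts a A)
    (h' : Lifts a' A') : Lifts ⁅a, a'⁆ ⁅A, A'⁆ := by
  constructor
  · refine LinearMap.ext fun x => ?_
    have h1 := fun x => LinearMap.congr_fun h.theta x
    have h2 := fun x => LinearMap.congr_fun h'.theta x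
    simp only [LinearMap.comp_apply] at h1 h2
    simp [Ring.lie_def, h1, h2]
  · refine LinearMap.ext fun x => ?_
    have h1 := fun x => LinearMap.congr_fun h.mulY x
    have h2 := fun x => LinearMap.congr_fun h'.mulY x
    simp only [LinearMap.comp_apply] at h1 h2
    simp [Ring.lie_def, h1, h2]

theorem Lifts.compress_lie {a : Module.End K (P K)} {A : Module.End K (PY K)} (h : Lifts a A)
    (T : Module.End K (PY K)) : compress b ⁅A, T⁆ = ⁅a, compress b T⁆ := by
  refine LinearMap.ext fun f => ?_
  have h1 := fun x => LinearMap.congr_fun h.theta x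
  have h2 := fun x => LinearMap.congr_fun h.mulY x
  simp only [LinearMap.comp_apply] at h1 h2
  simp [compress, Ring.lie_def, h1, h2, smul_sub]

theorem compressPoly_pencil_lie {a a' : Module.End K (P K)} {A A' : Module.End K (PY K)}
    (h : Lifts a A) (h' : Lifts a' A') (p : (Module.End K (PY K))[X]) :
    compressPoly b ⁅pencil A A', p⁆ = ⁅pencil a a', compressPoly b p⁆ := by
  have key {R : Type _} [Ring R] (r r' : R) (q : R[X]) (n : ℕ) :
      ⁅pencil r r', q⁆.coeff n = ⁅r, q.coeff n⁆
        + if n = 0 then 0 else ⁅r', q.coeff (n - 1)⁆ := by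
    rw [Ring.lie_def, pencil, add_mul, mul_add, X_mul, ← mul_assoc, mul_assoc, X_mul, ← mul_assoc]
    cases n <;> simp [Ring.lie_def]
    abel
  ext1 n
  rw [key, coeff_compressPoly, key, map_add, h.compress_lie, coeff_compressPoly]
  split_ifs
  · simp
  · rw [h'.compress_lie, coeff_compressPoly]

/-- The operator `e₀`, multiplication by `p₁ / (1 + b)`. -/
def creation₀ : Module.End K (P K) := (1 + b)⁻¹ • LinearMap.mulLeft K (psum K 1)

/-- The lift of `e₀` to `𝒫_Y`. -/
def creation₀Y : Module.End K (PY K) :=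
  (1 + b)⁻¹ • (LinearMap.lsmul (P K) (PY K) (psum K 1)).restrictScalars K

theorem creation₀Y_apply (x : PY K) : creation₀Y b x = (1 + b)⁻¹ • psum K 1 • x := rfl

theorem creation₀_apply (f : P K) : creation₀ b f = (1 + b)⁻¹ • (psum K 1 * f) := rfl

/-- The operator `e₁ = ∑ p_{i+1} i ∂/∂p_i`, which is the commutator of the Laplace–Beltrami operator
with `e₀`. -/
def creation₁ (K : Type*) [Field K] : Module.End K (P K) :=
  (euler (K := K) 1 : P K →ₗ[K] P K)

theorem creation₁_apply (f : P K) : creation₁ K f = euler 1 f := rfl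

theorem lifts_creation₀ : Lifts (creation₀ b) (creation₀Y b) := by
  constructor <;> refine LinearMap.ext fun x => ?_
  · simp [creation₀Y_apply, creation₀_apply, Theta_apply]
  · simp [creation₀Y_apply, creation₀_apply, mulY_apply, mul_smul]

theorem lifts_creation₁ : Lifts (creation₁ K) raise := by
  constructor <;> refine LinearMap.ext fun x => ?_
  · simp [Theta_apply, theta_raise, creation₁_apply]
  · simp [mulY_apply, creation₁_apply]

theorem lifts_laplace [CharZero K] : Lifts (laplace b) (laplaceY b) := by
  constructor <;> refine LinearMap.ext fun x => ?_
  · simp [Theta_apply, theta_laplaceY]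
  · simp [mulY_apply]

theorem laplace_lie_creation₀ [CharZero K] (hb : 1 + b ≠ 0) :
    ⁅laplace b, creation₀ b⁆ = creation₁ K := by
  refine LinearMap.ext fun f => ?_
  have h : twistVec b 1 = 0 := by
    simp [twistVec, Nat.antidiagonal_succ]
  simp only [Ring.lie_def, LinearMap.sub_apply, Module.End.mul_apply, creation₀_apply, map_smul,
    laplace_psum_mul, h, creation₁_apply, smul_add, map_zero, zero_mul, add_zero,
    add_sub_cancel_left, smul_smul, Nat.cast_one, mul_one]
  rw [inv_mul_cancel₀ hb, one_smul]

/-- The operator `e₂`, the commutator of the Laplace–Beltrami operator with `e₁`. -/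
def creation₂ : Module.End K (P K) := ⁅laplace b, creation₁ K⁆

theorem B_relations [CharZero K] (hb : 1 + b ≠ 0) (n : ℕ) :
    ⁅pencil (creation₁ K) (creation₀ b), B b n⁆ = 0 ∧
    ⁅pencil (creation₂ b) (creation₁ K), B b n⁆ = n • B b (n + 1) := by
  have hΓ : Gamma b = Yplus K * lax b := LinearMap.ext fun x => by
    simp [Gamma_apply, Yplus_apply]
  have h := pencil_lie_pow (x := Yplus K) (g := lax b) (r := raise) (q := creation₀Y b)
    (d := laplaceY b) ?_ ?_ ?_ ?_ ?_ ?_ n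
  · rw [B_eq_compressPoly, B_eq_compressPoly, hΓ]
    constructor
    · rw [← compressPoly_pencil_lie b lifts_creation₁ (lifts_creation₀ b), h.1, map_zero]
    · rw [creation₂, ← laplace_lie_creation₀ b hb, ← compressPoly_pencil_lie b
        ((lifts_laplace b).lie (by rw [laplace_lie_creation₀ b hb]; exact lifts_creation₁))
        ((lifts_laplace b).lie (lifts_creation₀ b)), h.2, map_nsmul]
  all_goals
    refine LinearMap.ext fun x => ?_
    rw [Ring.lie_def]
    simp [Yplus_apply, raise_shift, creation₀Y_apply, lax_raise,
      lax_psum_smul, laplaceY_shift, laplaceY_lax, smul_smul, hb]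

theorem B_one (hb : 1 + b ≠ 0) : B b 1 = pencil (creation₁ K) (creation₀ b) := by
  have h0 : compress b (Gamma b) = creation₁ K := LinearMap.ext fun f => by
    change Theta K (Gamma b ((1 + b)⁻¹ • mulY K 0 f)) = _
    rw [map_smul, map_smul, Theta_apply, Gamma_apply, mulY_apply, lax_smul_yvar_zero,
      LinearMap.map_smul_of_tower, LinearMap.map_smul_of_tower, smul_smul, inv_mul_cancel₀ hb,
      one_smul, creation₁_apply, euler_apply]
  have h1 : compress b (Yplus K) = creation₀ b := LinearMap.ext fun f => by
    change Theta K (Yplus K ((1 + b)⁻¹ • mulY K 0 f)) = _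
    rw [map_smul, map_smul, Theta_apply, Yplus_apply, mulY_apply, map_smul, map_smul, shift_yvar,
      theta_yvar, smul_eq_mul, mul_comm, creation₀_apply]
  rw [B_eq_compressPoly, pow_one]
  ext1 n
  rw [coeff_compressPoly]
  rcases n with _ | _ | n <;> simp [pencil, h0, h1, coeff_X, coeff_C]

theorem coeff_B_eq_zero (n l : ℕ) (h : n < l) : (B b n).coeff l = 0 := by
  rw [B_eq_compressPoly, coeff_compressPoly, coeff_eq_zero_of_natDegree_lt, map_zero]
  refine lt_of_le_of_lt (natDegree_pow_le_of_le (m := 1) n ?_) (by simpa using h)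
  refine natDegree_add_le_of_degree_le (by simp) ?_
  exact (natDegree_mul_le.trans (add_le_add natDegree_X_le (natDegree_C _).le))

end

/-! ### Zero curvature for polynomials in the spectral parameter -/

theorem derivative_pencil_lie {A : Type*} [Ring A] (a a' : A) (p : A[X]) :
    derivative ⁅pencil a a', p⁆ = ⁅pencil a a', derivative p⁆ + ⁅C a', p⁆ := by
  have h : derivative (pencil a a') = C a' := by simp [pencil]
  simp only [Ring.lie_def, derivative_sub, derivative_mul, h]
  abel

theorem C_lie_mk {R : Type*} [Ring R] (a : R) (F : ℕ → R) :
    ⁅PowerSeries.C a, PowerSeries.mk F⁆ = PowerSeries.mk fun n => ⁅a, F n⁆ := by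
  ext n
  simp [Ring.lie_def]

section

variable {S A : Type*} [Ring S] [Ring A] (φ : S[X] →+* A)

theorem smul_pencil (w : Subring.center (PowerSeries A))
    (hw : (w : PowerSeries A) = PowerSeries.C (φ X)) (a a' : S) :
    PowerSeries.C (φ (C a)) + w • PowerSeries.C (φ (C a')) = PowerSeries.C (φ (pencil a a')) := by
  rw [Subring.smul_def, hw, smul_eq_mul, ← map_mul, ← map_mul, ← map_add, ← map_add, pencil]

/-- The two families of relations in `S[u]`, and their derivatives in `u`, as equations between
power series in `t` over a ring to which `S[u]` maps. -/
theorem map_relations {e₀ e₁ e₂ : S} {q : ℕ → S[X]}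
    (h1 : ∀ n, ⁅pencil e₁ e₀, q n⁆ = 0)
    (h2 : ∀ n : ℕ, ((n : S[X]) + 1) * q (n + 1)
      = ⁅pencil e₂ e₁, q n⁆ + if n = 0 then pencil e₁ e₀ else 0)
    (w : Subring.center (PowerSeries A)) (hw : (w : PowerSeries A) = PowerSeries.C (φ X))
    {f f' E₀ E₁ E₂ : PowerSeries A}
    (hf : f = PowerSeries.mk fun n => φ (q n))
    (hf' : f' = PowerSeries.mk fun n => φ (derivative (q n)))
    (hE₀ : E₀ = PowerSeries.C (φ (C e₀))) (hE₁ : E₁ = PowerSeries.C (φ (C e₁)))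
    (hE₂ : E₂ = PowerSeries.C (φ (C e₂))) :
    ⁅E₁ + w • E₀, f⁆ = 0 ∧ ⁅E₁ + w • E₀, f'⁆ = -⁅E₀, f⁆ ∧
    seriesDeriv f = ⁅E₂ + w • E₁, f⁆ + (E₁ + w • E₀) ∧
    seriesDeriv f' = ⁅E₂ + w • E₁, f'⁆ + ⁅E₁, f⁆ + E₀ := by
  have hφ (p r : S[X]) : ⁅φ p, φ r⁆ = φ ⁅p, r⁆ := by
    simp [Ring.lie_def]
  subst hE₀ hE₁ hE₂ hf hf'
  rw [smul_pencil φ w hw, smul_pencil φ w hw]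
  simp only [C_lie_mk, hφ]
  refine ⟨?_, ?_, ?_, ?_⟩
  · ext n
    simp [h1]
  · ext n
    have h := derivative_pencil_lie e₁ e₀ (q n)
    rw [h1, derivative_zero] at h
    rw [PowerSeries.coeff_mk, map_neg, PowerSeries.coeff_mk, ← map_neg,
      eq_neg_of_add_eq_zero_left h.symm]
  · ext n
    rw [coeff_seriesDeriv, PowerSeries.coeff_mk, map_add, PowerSeries.coeff_mk, PowerSeries.coeff_C]
    have h := congr_arg φ (h2 n)
    simp only [map_mul, map_add, map_natCast, map_one] at h
    rw [h]
    split_ifs <;> simp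
  · ext n
    rw [coeff_seriesDeriv, PowerSeries.coeff_mk, map_add, map_add, PowerSeries.coeff_mk,
      PowerSeries.coeff_mk, PowerSeries.coeff_C, ← map_add, ← derivative_pencil_lie]
    have h := congr_arg (fun p => φ (derivative p)) (h2 n)
    have h3 : derivative (((n : S[X]) + 1) * q (n + 1))
        = ((n : S[X]) + 1) * derivative (q (n + 1)) := by
      rw [derivative_mul]
      simp
    have h4 : derivative (pencil e₁ e₀) = C e₀ := by simp [pencil]
    simp only [h3, map_mul, map_add, map_natCast, map_one] at h
    rw [h]
    split_ifs <;> simp [h4]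

end

theorem isAddTorsionFree_polynomial {S : Type*} [Ring S] [IsAddTorsionFree S] :
    IsAddTorsionFree S[X] where
  nsmul_right_injective n hn p r h := by
    ext i
    refine nsmul_right_injective hn ?_
    simpa using congr_arg (fun p => coeff p i) h

theorem C_mem_center {A : Type*} [Ring A] {a : A} (h : ∀ x, a * x = x * a) :
    PowerSeries.C a ∈ Subring.center (PowerSeries A) :=
  Subring.mem_center_iff.2 fun F => by ext n; simp [h]

/-- The vanishing of the curvature in `S[u][v]⟦t⟧`, where `F(u)` and `F(v)` are the images of
`∑ tⁿ q n` under the two embeddings of `S[X]` into `S[X][X]`, read off at `u^ℓ v^m tⁿ`. -/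
theorem sum_lie_coeff {S : Type*} [Ring S] [IsAddTorsionFree S] {e₀ e₁ e₂ : S} {q : ℕ → S[X]}
    (h0 : q 0 = 0) (h1 : ∀ n, ⁅pencil e₁ e₀, q n⁆ = 0)
    (h2 : ∀ n : ℕ, ((n : S[X]) + 1) * q (n + 1)
      = ⁅pencil e₂ e₁, q n⁆ + if n = 0 then pencil e₁ e₀ else 0) (ℓ m n : ℕ) :
    ∑ x ∈ antidiagonal n, ⁅(q x.1).coeff ℓ, (q x.2).coeff m⁆
      = (if ℓ = 0 then (m + 1) • (q n).coeff (m + 1) else 0)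
        - (if m = 0 then (ℓ + 1) • (q n).coeff (ℓ + 1) else 0) := by
  have : IsAddTorsionFree S[X] := isAddTorsionFree_polynomial
  have : IsAddTorsionFree S[X][X] := isAddTorsionFree_polynomial
  have hX : ∀ x : S[X][X], C X * x = x * C X := fun x => by
    ext1 n
    rw [coeff_C_mul, coeff_mul_C, X_mul]
  obtain ⟨u, hu⟩ : ∃ u : Subring.center (PowerSeries S[X][X]),
      (u : PowerSeries S[X][X]) = PowerSeries.C ((C : S[X] →+* S[X][X]) X) :=
    ⟨⟨_, C_mem_center hX⟩, rfl⟩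
  obtain ⟨v, hv⟩ : ∃ v : Subring.center (PowerSeries S[X][X]),
      (v : PowerSeries S[X][X]) = PowerSeries.C (mapRingHom (C : S →+* S[X]) X) :=
    ⟨⟨_, C_mem_center fun x => by simp [X_mul]⟩, rfl⟩
  obtain ⟨f1, f2, f3, f4⟩ := map_relations C h1 h2 u hu rfl rfl rfl rfl rfl
  obtain ⟨g1, g2, g3, g4⟩ := map_relations (mapRingHom (C : S →+* S[X])) h1 h2 v hv
    (E₀ := PowerSeries.C (C (C e₀))) (E₁ := PowerSeries.C (C (C e₁)))
    (E₂ := PowerSeries.C (C (C e₂))) rfl rfl (by simp) (by simp) (by simp)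
  have h := zero_curvature u v f1 g1 f2 g2 f3 g3 f4 g4 (by simp [h0]) (by simp [h0]) (by simp [h0])
  have h := congr_arg (fun F => ((PowerSeries.coeff n F).coeff m).coeff ℓ) h
  rw [Ring.lie_def, map_sub, PowerSeries.coeff_mul, PowerSeries.coeff_mul,
    ← Nat.sum_antidiagonal_swap (n := n), ← sum_sub_distrib] at h
  simp only [map_sub, PowerSeries.coeff_mk, finsetSum_coeff, coeff_sub,
    coe_mapRingHom, coeff_C_mul, coeff_mul_C, coeff_map, coeff_derivative, Prod.fst_swap,
    Prod.snd_swap] at h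
  have hc (a : S) (k : ℕ) : a * ((k : S) + 1) = (k + 1) • a := by
    rw [nsmul_eq_mul, ← Nat.cast_succ, (Nat.cast_commute _ _).eq]
  have hs := Nat.sum_antidiagonal_swap (n := n) (f := fun x => ⁅(q x.1).coeff ℓ, (q x.2).coeff m⁆)
  rw [← hs]
  refine h.trans ?_
  rw [coeff_C, coeff_C]
  congr 1 <;> split_ifs <;> simp only [coeff_derivative, hc, coeff_zero]

/-! ### The commutators of the operators `𝒞_ℓ` -/

section

variable {K : Type*} [Field K] (b : K)

/-- The coefficient `ℬ_n(u) / n` of `tⁿ` in `F(t, u)`. The junk value at `n = 0` is zero, which is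
the constant term of `F`. -/
def scaledB (n : ℕ) : (Module.End K (P K))[X] := (n : K)⁻¹ • B b n

theorem coeff_Cop (ℓ n : ℕ) : PowerSeries.coeff n (Cop b ℓ) = (scaledB b n).coeff ℓ := by
  rw [Cop, PowerSeries.coeff_mk, scaledB, coeff_smul]
  split_ifs with h
  · rw [Ccoef, Nat.add_sub_cancel' h.1]
  · rcases Nat.eq_zero_or_pos n with rfl | hn
    -- Both sides are zero at `n = 0`, since `0⁻¹ = 0` in `K`.
    · simp
    · rw [coeff_B_eq_zero b n ℓ (by omega), smul_zero]

theorem pencil_lie_scaledB [CharZero K] (hb : 1 + b ≠ 0) (n : ℕ) :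
    ⁅pencil (creation₁ K) (creation₀ b), scaledB b n⁆ = 0 := by
  have h := (B_relations b hb n).1
  rw [Ring.lie_def] at h ⊢
  rw [scaledB, mul_smul_comm, smul_mul_assoc, ← smul_sub, h, smul_zero]

theorem scaledB_succ [CharZero K] (hb : 1 + b ≠ 0) (n : ℕ) :
    (n + 1) * scaledB b (n + 1) = ⁅pencil (creation₂ b) (creation₁ K), scaledB b n⁆
      + if n = 0 then pencil (creation₁ K) (creation₀ b) else 0 := by
  have h := (B_relations b hb n).2
  have h1 : (n + 1) * scaledB b (n + 1) = B b (n + 1) := by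
    have : ((n + 1 : ℕ) : K) ≠ 0 := Nat.cast_ne_zero.2 n.succ_ne_zero
    rw [scaledB, ← Nat.cast_succ, ← nsmul_eq_mul, ← Nat.cast_smul_eq_nsmul K, smul_smul,
      mul_inv_cancel₀ this, one_smul]
  rw [h1]
  split_ifs with hn
  · subst hn
    simp [scaledB, B_one b hb, Ring.lie_def]
  · have : (n : K) ≠ 0 := Nat.cast_ne_zero.2 hn
    rw [Ring.lie_def] at h ⊢
    rw [scaledB, mul_smul_comm, smul_mul_assoc, ← smul_sub, h, ← Nat.cast_smul_eq_nsmul K,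
      smul_smul, inv_mul_cancel₀ this, one_smul, add_zero]

/-- All the commutators of the `𝒞_ℓ`, over any field of characteristic zero, for `b ≠ -1`. -/
theorem Cop_lie [CharZero K] (hb : 1 + b ≠ 0) (ℓ m : ℕ) :
    ⁅Cop b ℓ, Cop b m⁆ = (if ℓ = 0 then (m + 1) • Cop b (m + 1) else 0)
        - (if m = 0 then (ℓ + 1) • Cop b (ℓ + 1) else 0) := by
  have : IsAddTorsionFree (Module.End K (P K)) :=
    { nsmul_right_injective := fun n hn x y h => by
        have h0 : (n : K) ≠ 0 := Nat.cast_ne_zero.2 hn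
        simp only [← Nat.cast_smul_eq_nsmul K] at h
        exact smul_right_injective _ h0 h }
  ext1 n
  have h := sum_lie_coeff (by simp [scaledB]) (pencil_lie_scaledB b hb) (scaledB_succ b hb) ℓ m n
  have h1 : PowerSeries.coeff n ⁅Cop b ℓ, Cop b m⁆
      = ∑ x ∈ antidiagonal n, ⁅(scaledB b x.1).coeff ℓ, (scaledB b x.2).coeff m⁆ := by
    simp only [Ring.lie_def, map_sub, PowerSeries.coeff_mul, coeff_Cop, sum_sub_distrib]
    congr 1
    exact (Nat.sum_antidiagonal_swap (n := n)
      (f := fun x => (scaledB b x.1).coeff m * (scaledB b x.2).coeff ℓ)).symm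
  rw [h1, h, map_sub]
  congr 1 <;> split_ifs <;> simp only [map_nsmul, coeff_Cop, map_zero]

end

end

end CatalyticOperators

/-- The commutation relations, in the ring `End(𝒫)⟦t⟧` over `ℚ(b)` with `b = RatFunc.X`. -/
theorem theorem6p1 (m : ℕ) (hm : 0 < m) :
    (∀ ℓ : ℕ, 0 < ℓ →
      ⁅CatalyticOperators.Cop (RatFunc.X : RatFunc ℚ) ℓ,
        CatalyticOperators.Cop (RatFunc.X : RatFunc ℚ) m⁆ = 0) ∧
    ⁅CatalyticOperators.Cop (RatFunc.X : RatFunc ℚ) 0,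
        CatalyticOperators.Cop (RatFunc.X : RatFunc ℚ) m⁆ =
      (m + 1) • CatalyticOperators.Cop (RatFunc.X : RatFunc ℚ) (m + 1) := by
  have : CharZero (RatFunc ℚ) := charZero_of_injective_algebraMap (algebraMap ℚ _).injective
  have hb : (1 + RatFunc.X : RatFunc ℚ) ≠ 0 := by
    rw [← RatFunc.algebraMap_X, ← map_one (algebraMap (Polynomial ℚ) _), ← map_add, add_comm,
      ← Polynomial.C_1]
    exact RatFunc.algebraMap_ne_zero (Polynomial.X_add_C_ne_zero 1)
  refine ⟨fun ℓ hℓ => ?_, ?_⟩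
  · rw [CatalyticOperators.Cop_lie _ hb, if_neg hℓ.ne', if_neg hm.ne', sub_zero]
  · rw [CatalyticOperators.Cop_lie _ hb, if_pos rfl, if_neg hm.ne', sub_zero]
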